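/- Let $E=\mathbb C/\Lambda$ be a complex elliptic curve with complex multiplication, and let $\operatorname{End}(E)$ be its ring of holomorphic group endomorphisms. Suppose $\operatorname{End}(E)\cong\mathbb Z[\sigma]$, where either $\sigma=\sqrt{-e}$ with $e$ a positive integer, or $\sigma=\tfrac12(1+\sqrt{-e})$ with $e$ a positive integer, $e\equiv 3 \pmod 4$. On the abelian surface $E\times E$ let $F_1=\{0\}\times E$, $F_2=E\times\{0\}$, let $\Delta=\{(x,x)\mid x\in E\}$ be the diagonal, and let $\Gamma=\{(x,\varphi(x))\mid x\in E\}$ be the graph of the endomorphism $\varphi\in\operatorname{End}(E)$ corresponding to $\sigma$. Then the matrix of intersection numbers $C\cdot D=\int_{E\times E}c_1(\mathcal O(C))\wedge c_1(\mathcal O(D))$ of the four curves $(F_1,F_2,\Delta,\Gamma)$ is $$\begin{pmatrix} 0&1&1&1\\ 1&0&1&|\sigma|^2\\ 1&1&0&|1-\sigma|^2\\ 1&|\sigma|^2&|1-\sigma|^2&0\end{pmatrix}.$$ -/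

import Mathlib

open Topology

noncomputable section

namespace EllipticSquare

/-- The complex elliptic curve `E = ℂ / (ℤ ω₁ + ℤ ω₂)`. -/
abbrev Curve (L : PeriodPair) : Type := ℂ ⧸ L.lattice

/-- The projection `ℂ → E`. -/
def proj (L : PeriodPair) (z : ℂ) : Curve L := Submodule.Quotient.mk z

/-- The projection `ℂ × ℂ → E × E`. -/
def proj₂ (L : PeriodPair) (v : ℂ × ℂ) : Curve L × Curve L := (proj L v.1, proj L v.2)

/-- A map `E → E` is holomorphic if near every point it lifts to a holomorphic function in the
coordinate of `ℂ`. -/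
def IsHolomorphic (L : PeriodPair) (φ : Curve L → Curve L) : Prop :=
  ∀ z : ℂ, ∃ g : ℂ → ℂ, AnalyticAt ℂ g z ∧ ∀ᶠ w in 𝓝 z, φ (proj L w) = proj L (g w)

/-- The endomorphism ring `End(E)`: the holomorphic group endomorphisms of `E`, under pointwise
addition and composition. -/
def endRing (L : PeriodPair) : Subring (AddMonoid.End (Curve L)) where
  carrier := {φ | IsHolomorphic L φ}
  mul_mem' := by
    intro φ ψ hφ hψ z
    obtain ⟨g, hg, hg'⟩ := hψ z
    obtain ⟨h, hh, hh'⟩ := hφ (g z)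
    refine ⟨h ∘ g, hh.comp hg, ?_⟩
    filter_upwards [hg', hg.continuousAt.eventually hh'] with w h1 h2
    show φ (ψ (proj L w)) = _
    rw [h1, h2, Function.comp_apply]
  one_mem' := fun z => ⟨id, analyticAt_id, by simp⟩
  add_mem' := by
    intro φ ψ hφ hψ z
    obtain ⟨g, hg, hg'⟩ := hφ z
    obtain ⟨h, hh, hh'⟩ := hψ z
    refine ⟨g + h, hg.add hh, ?_⟩
    filter_upwards [hg', hh'] with w h1 h2
    show φ (proj L w) + ψ (proj L w) = _
    rw [h1, h2]
    rfl
  zero_mem' := fun z => ⟨0, analyticAt_const, by simp [proj]⟩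
  neg_mem' := by
    intro φ hφ z
    obtain ⟨g, hg, hg'⟩ := hφ z
    refine ⟨-g, hg.neg, ?_⟩
    filter_upwards [hg'] with w h1
    show -(φ (proj L w)) = _
    rw [h1]
    rfl

/-- The curve `{0} × E`. -/
def fibre₁ (L : PeriodPair) : Set (Curve L × Curve L) := {p | p.1 = 0}

/-- The curve `E × {0}`. -/
def fibre₂ (L : PeriodPair) : Set (Curve L × Curve L) := {p | p.2 = 0}

/-- The diagonal of `E × E`. -/
def diag (L : PeriodPair) : Set (Curve L × Curve L) := {p | p.2 = p.1}

/-- The graph `{(x, φ x) | x ∈ E}`. -/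
def graph (L : PeriodPair) (φ : Curve L → Curve L) : Set (Curve L × Curve L) :=
  {p | p.2 = φ p.1}

/-- The element `(λ₁, λ₂)` of the lattice of `E × E`, as a vector of `ℂ × ℂ`. -/
def period (L : PeriodPair) (m : L.lattice × L.lattice) : ℂ × ℂ := ((m.1 : ℂ), (m.2 : ℂ))

/-- `ϑ` is a theta function of the reduced curve `C ⊆ E × E`: an entire function on `ℂ × ℂ`, not
identically zero, whose germ at every point generates the ideal of all germs of holomorphic
functions that vanish on the preimage of `C`. In other words, the line bundle `𝒪(C)` pulls back
to the trivial bundle on `ℂ × ℂ`, with `ϑ` the pullback of its canonical section. -/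
def IsThetaFunction (L : PeriodPair) (C : Set (Curve L × Curve L)) (ϑ : ℂ × ℂ → ℂ) : Prop :=
  (∀ v, AnalyticAt ℂ ϑ v) ∧ ϑ ≠ 0 ∧ (∀ v, proj₂ L v ∈ C → ϑ v = 0) ∧
  ∀ (v : ℂ × ℂ) (f : ℂ × ℂ → ℂ), AnalyticAt ℂ f v →
    (∀ᶠ w in 𝓝 v, proj₂ L w ∈ C → f w = 0) →
    ∃ h : ℂ × ℂ → ℂ, AnalyticAt ℂ h v ∧ ∀ᶠ w in 𝓝 v, f w = ϑ w * h w

/-- `A` is the first Chern class `c₁(𝒪(C))`, under the identification of `H²(E × E, ℤ)` with the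
integral alternating forms on the lattice. If `exp (2πi g_m(v)) = ϑ(v + m) / ϑ(v)` is the factor of
automorphy of `𝒪(C)`, it is the form
`A(m, n) = g_n(v + m) + g_m(v) - g_m(v + n) - g_n(v)`, which depends neither on `v` nor on the
choice of `ϑ` and of the logarithms `g_m`. (A continuous logarithm of a nowhere vanishing
holomorphic function is automatically holomorphic.) -/
def IsChernForm (L : PeriodPair) (C : Set (Curve L × Curve L))
    (A : L.lattice × L.lattice → L.lattice × L.lattice → ℤ) : Prop :=
  ∃ (ϑ : ℂ × ℂ → ℂ) (g : L.lattice × L.lattice → ℂ × ℂ → ℂ),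
    IsThetaFunction L C ϑ ∧ (∀ m, Continuous (g m)) ∧
    (∀ m v, ϑ (v + period L m) = Complex.exp (2 * Real.pi * Complex.I * g m v) * ϑ v) ∧
    ∀ m n v, (A m n : ℂ) =
      g n (v + period L m) + g m v - g m (v + period L n) - g n v

open Classical in
/-- The form representing `c₁(𝒪(C))`; by convention `0` if `C` is not a curve. -/
def chernForm (L : PeriodPair) (C : Set (Curve L × Curve L)) :
    L.lattice × L.lattice → L.lattice × L.lattice → ℤ :=
  if h : ∃ A, IsChernForm L C A then h.choose else 0

/-- The basis `(ω₁, 0), (ω₂, 0), (0, ω₁), (0, ω₂)` of the lattice of `E × E`. It is positively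
oriented for the complex orientation of `ℂ × ℂ`, whichever orientation `(ω₁, ω₂)` has. -/
def latticeBasis (L : PeriodPair) : Fin 4 → L.lattice × L.lattice :=
  ![(⟨L.ω₁, L.ω₁_mem_lattice⟩, 0), (⟨L.ω₂, L.ω₂_mem_lattice⟩, 0),
    (0, ⟨L.ω₁, L.ω₁_mem_lattice⟩), (0, ⟨L.ω₂, L.ω₂_mem_lattice⟩)]

/-- The integer `∫ A ∧ B` over `E × E` of two classes in `H²(E × E, ℤ)`: the cup product of
alternating forms is their wedge product, evaluated on a positively oriented lattice basis. -/
def cupPairing (L : PeriodPair) (A B : L.lattice × L.lattice → L.lattice × L.lattice → ℤ) : ℤ :=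
  let b := latticeBasis L
  A (b 0) (b 1) * B (b 2) (b 3) - A (b 0) (b 2) * B (b 1) (b 3) + A (b 0) (b 3) * B (b 1) (b 2)
    + A (b 1) (b 2) * B (b 0) (b 3) - A (b 1) (b 3) * B (b 0) (b 2) + A (b 2) (b 3) * B (b 0) (b 1)

/-- The intersection number `C · D = ∫ c₁(𝒪(C)) ∧ c₁(𝒪(D))` of curves on `E × E`. -/
def intersectionNumber (L : PeriodPair) (C D : Set (Curve L × Curve L)) : ℤ :=
  cupPairing L (chernForm L C) (chernForm L D)

/-- The intersection matrix of a tuple of curves on `E × E`. -/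
def intersectionMatrix (L : PeriodPair) {n : ℕ} (C : Fin n → Set (Curve L × Curve L)) :
    Matrix (Fin n) (Fin n) ℤ :=
  Matrix.of fun i j => intersectionNumber L (C i) (C j)

end EllipticSquare

end

/-! Each of the four curves is cut out on `ℂ × ℂ` by the condition `l v ∈ Λ` for a linear form `l`:
`z₁` for the fibre `{0} × E`, and `z₂ - α z₁` for the graph of multiplication by `α` (`E × {0}` and
the diagonal are the graphs of 0 and 1). If `s` is a one-variable theta function with simple zeros
exactly on `Λ`, then `s ∘ l` is a theta function of the curve. Its automorphy exponents are affine
in `l`, so `c₁` is the pullback along `l` of the form `ε (p q' - q p')` on `Λ`, with one sign `ε`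
for all curves (`exists_chernForm_eq`). Since `chernForm` is a choice, this needs
`IsChernForm.unique`.

The wedge of the forms of two graphs with matrices `M`, `M'` is then `det (M - M')`, and
multiplication by `β` has determinant `|β|²` on `Λ` (`det_eq_norm_sq`); the fibre pairs to 1 with
every graph and to 0 with itself.

The endomorphism `φ` lifts to multiplication by some `α` (`exists_multiplier`). The isomorphism with
`ℤ[σ]` is only algebraic, so it determines `α` up to conjugation, through the quadratic equation of
`σ`; this suffices for `|α|` and `|1 - α|`. -/

noncomputable section

namespace EllipticSquare

/-! ### Division of analytic germs by a linear equation -/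

section Division

variable {E : Type*} [NormedAddCommGroup E] [NormedSpace ℂ E]

/-- The difference of the values of a multilinear map on two diagonals, as a telescoping sum. -/
lemma multilinear_diag_sub_diag {n : ℕ}
    (p : ContinuousMultilinearMap ℂ (fun _ : Fin (n + 1) => E) ℂ) (x y : E) :
    p (fun _ => x) - p (fun _ => y) =
      ∑ i : Fin (n + 1), p (i.insertNth (x - y) fun j => if i.succAbove j < i then y else x) := by
  let S : ℕ → ℂ := fun k => p fun j => if (j : ℕ) < k then y else x
  have h0 : S 0 = p fun _ => x := by simp [S]
  have h1 : S (n + 1) = p fun _ => y := by simp only [S, Fin.is_lt, if_true]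
  rw [← h0, ← h1, ← neg_sub, ← Finset.sum_range_sub, ← Finset.sum_neg_distrib,
    ← Fin.sum_univ_eq_sum_range (fun k => -(S (k + 1) - S k))]
  refine Finset.sum_congr rfl fun i _ => ?_
  set m : Fin (n + 1) → E := fun j => if j < i then y else x with hm
  have e1 : (fun j : Fin (n + 1) => if (j : ℕ) < (i : ℕ) then y else x) = Function.update m i x := by
    funext j
    by_cases hj : j = i
    · subst hj; simp
    · rw [Function.update_of_ne hj, hm]; rfl
  have e2 : (fun j : Fin (n + 1) => if (j : ℕ) < (i : ℕ) + 1 then y else x) =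
      Function.update m i y := by
    funext j
    by_cases hj : j = i
    · subst hj; simp
    · have : (j : ℕ) ≠ i := fun h => hj (Fin.ext h)
      simp only [Function.update_of_ne hj, hm, Fin.lt_def]
      congr 1
      simp only [eq_iff_iff]; omega
  have e3 : (i.insertNth (x - y) fun j => if i.succAbove j < i then y else x : Fin (n + 1) → E) =
      Function.update m i (x - y) := by
    refine (Fin.eq_insertNth_iff.2 ⟨by simp, ?_⟩).symm
    funext j
    simp [Fin.removeNth, hm]
  simp only [S]
  rw [e1, e2, e3, p.map_update_sub]
  ring

/-- The power series of the quotient by `l` of a function with power series `p` that vanishes on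
the kernel of `l`, where `e` is a vector with `l e = 1` and `P` the projection along `e`. -/
def quotientSeries (p : FormalMultilinearSeries ℂ E ℂ) (P : E →L[ℂ] E) (e : E) :
    FormalMultilinearSeries ℂ E ℂ := fun n =>
  ∑ i : Fin (n + 1), ((p (n + 1)).curryMid i e).compContinuousLinearMap
    fun j => if i.succAbove j < i then P else ContinuousLinearMap.id ℂ E

/-- In the telescoping sum between `z` and its projection, the distinguished slot of each term holds
`l z • e`, so multilinearity pulls out the factor `l z`. -/
lemma quotientSeries_apply (p : FormalMultilinearSeries ℂ E ℂ) (l : E →L[ℂ] ℂ) (e : E) (n : ℕ)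
    (z : E) :
    l z * quotientSeries p (ContinuousLinearMap.id ℂ E - l.smulRight e) e n (fun _ => z) =
      p (n + 1) (fun _ => z) - p (n + 1) (fun _ => z - l z • e) := by
  rw [multilinear_diag_sub_diag, quotientSeries, sum_apply,
    Finset.mul_sum]
  refine Finset.sum_congr rfl fun i _ => ?_
  have h := ((p (n + 1)).curryMid i).map_smul (l z) e
  rw [sub_sub_cancel, ← ContinuousMultilinearMap.curryMid_apply, h]
  simp only [ContinuousMultilinearMap.compContinuousLinearMap_apply,
    smul_apply, smul_eq_mul]
  congr 2
  funext j
  split_ifs <;> simp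

lemma norm_quotientSeries_le (p : FormalMultilinearSeries ℂ E ℂ) (P : E →L[ℂ] E) (e : E) (n : ℕ) :
    ‖quotientSeries p P e n‖ ≤ (n + 1) * (‖p (n + 1)‖ * ‖e‖ * (1 + ‖P‖) ^ n) := by
  refine (norm_sum_le _ _).trans ?_
  have : ∀ i ∈ (Finset.univ : Finset (Fin (n + 1))),
      ‖((p (n + 1)).curryMid i e).compContinuousLinearMap (fun j => if i.succAbove j < i then P else ContinuousLinearMap.id ℂ E)‖ ≤
      ‖p (n + 1)‖ * ‖e‖ * (1 + ‖P‖) ^ n := by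
    intro i _
    refine (ContinuousMultilinearMap.norm_compContinuousLinearMap_le _ _).trans ?_
    refine mul_le_mul ?_ ?_ (Finset.prod_nonneg fun _ _ => norm_nonneg _) (by positivity)
    · refine (ContinuousLinearMap.le_opNorm _ _).trans ?_
      rw [ContinuousMultilinearMap.norm_curryMid]
    · refine (Finset.prod_le_prod (g := fun _ => 1 + ‖P‖) (fun _ _ => norm_nonneg _)
        fun j _ => ?_).trans (by simp)
      split_ifs
      · linarith
      · linarith [ContinuousLinearMap.norm_id_le (𝕜 := ℂ) (E := E), norm_nonneg P]
  refine (Finset.sum_le_card_nsmul _ _ _ this).trans ?_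
  simp

lemma quotientSeries_radius_pos (p : FormalMultilinearSeries ℂ E ℂ) (hp : 0 < p.radius)
    (P : E →L[ℂ] E) (e : E) : 0 < (quotientSeries p P e).radius := by
  obtain ⟨r, hr0, hr⟩ := ENNReal.lt_iff_exists_nnreal_btwn.1 hp
  have hr0' : (0 : ℝ) < r := by simpa using hr0
  obtain ⟨K, hK0, hK⟩ := p.norm_mul_pow_le_of_lt_radius hr
  set c : NNReal := 1 + ‖P‖₊ with hc
  have hc0 : (0 : ℝ) < c := by rw [hc]; positivity
  have hcn : (c : ℝ) = 1 + ‖P‖ := by simp [hc]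
  -- Here `c` absorbs the norms of the maps in the remaining `n` slots, and 2 absorbs the number `n
  -- + 1 ≤ 2 ^ n` of summands.
  refine lt_of_lt_of_le ?_ ((quotientSeries p P e).le_radius_of_bound (r := r / (2 * c))
    (‖e‖ * K / r) fun n => ?_)
  · have : 0 < r / (2 * c) := by
      rw [← NNReal.coe_pos]; push_cast; positivity
    exact_mod_cast this
  · have h2 : ((n : ℝ) + 1) ≤ 2 ^ n := by exact_mod_cast Nat.succ_le_of_lt n.lt_two_pow_self
    calc ‖quotientSeries p P e n‖ * ((r / (2 * c) : NNReal) : ℝ) ^ n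
        ≤ ((n + 1) * (‖p (n + 1)‖ * ‖e‖ * (1 + ‖P‖) ^ n)) * ((r / (2 * c) : NNReal) : ℝ) ^ n := by
          gcongr
          exact norm_quotientSeries_le p P e n
      _ = ((n + 1) / 2 ^ n) * (‖e‖ * (‖p (n + 1)‖ * (r : ℝ) ^ (n + 1)) / r) := by
          rw [← hcn]; push_cast
          rw [div_pow, mul_pow]
          field_simp
          ring
      _ ≤ 1 * (‖e‖ * K / r) := by
          gcongr
          · exact div_le_one_of_le₀ h2 (by positivity)
          · exact hK (n + 1)
      _ = _ := one_mul _

/-- An analytic function that vanishes on a hyperplane is divisible by its equation. -/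
theorem exists_eq_sub_mul_of_eq_zero {f : E → ℂ} {v : E} (hf : AnalyticAt ℂ f v)
    (l : E →L[ℂ] ℂ) (hl : l ≠ 0) (h0 : ∀ᶠ w in 𝓝 v, l w = l v → f w = 0) :
    ∃ h : E → ℂ, AnalyticAt ℂ h v ∧ ∀ᶠ w in 𝓝 v, f w = (l w - l v) * h w := by
  obtain ⟨e, he⟩ : ∃ e, l e = 1 := by
    obtain ⟨e, he⟩ : ∃ e, l e ≠ 0 := by
      by_contra! H
      exact hl (ContinuousLinearMap.ext H)
    exact ⟨(l e)⁻¹ • e, by simp [he]⟩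
  obtain ⟨p, hp⟩ := hf
  have hq := (quotientSeries p (ContinuousLinearMap.id ℂ E - l.smulRight e)
    e).hasFPowerSeriesOnBall (quotientSeries_radius_pos p hp.radius_pos _ e)
  set q := quotientSeries p (ContinuousLinearMap.id ℂ E - l.smulRight e) e with hqdef
  have hsub : Filter.Tendsto (fun w => w - v) (𝓝 v) (𝓝 0) := by
    have : ContinuousAt (fun w : E => w - v) v := by fun_prop
    simpa [ContinuousAt] using this
  have hproj : Filter.Tendsto (fun w => (w - v) - l (w - v) • e) (𝓝 v) (𝓝 0) := by
    have : ContinuousAt (fun w : E => (w - v) - l (w - v) • e) v := by fun_prop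
    simpa [ContinuousAt] using this
  have hproj' : Filter.Tendsto (fun w => v + ((w - v) - l (w - v) • e)) (𝓝 v) (𝓝 v) := by
    simpa using hproj.const_add v
  refine ⟨fun w => q.sum (w - v), ?_, ?_⟩
  · have h1 : AnalyticAt ℂ q.sum (v - v) := by rw [sub_self]; exact hq.analyticAt
    exact h1.fun_comp (f := fun w => w - v) (by fun_prop)
  · filter_upwards [hsub.eventually hp.eventually_hasSum, hproj.eventually hp.eventually_hasSum,
      hsub.eventually hq.hasFPowerSeriesAt.eventually_hasSum, hproj'.eventually h0]
      with w h1 h2 h3 h4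
    -- The projection of `w` along `e` lies on the hyperplane, so subtracting the series of `f`
    -- there leaves the value at `w`. The degree 0 terms cancel, which allows the index shift.
    have h5 : f (v + (w - v - l (w - v) • e)) = 0 := h4 (by simp [he])
    rw [add_sub_cancel] at h1
    rw [h5] at h2
    rw [zero_add] at h3
    have h6 := h1.sub h2
    rw [sub_zero, ← hasSum_nat_add_iff' 1] at h6
    have hz : (p 0 fun _ => w - v) - (p 0 fun _ => w - v - l (w - v) • e) = 0 := by
      rw [sub_eq_zero]; congr 1; funext i; exact i.elim0
    simp only [Finset.range_one, Finset.sum_singleton, hz, sub_zero] at h6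
    have h7 := h3.mul_left (l (w - v))
    simp only [hqdef, quotientSeries_apply] at h7
    rw [h6.unique h7, map_sub]

end Division


/-! ### A theta function of one variable -/

section Theta

open Complex

/-- The product `∏ (1 - qⁿ w)` over `n ≥ 0`. -/
def qProd (q w : ℂ) : ℂ := ∏' n : ℕ, (1 + -(q ^ n * w))

lemma summable_norm_pow_mul {q : ℂ} (hq : ‖q‖ < 1) (w : ℂ) :
    Summable fun n : ℕ => ‖-(q ^ n * w)‖ := by
  simpa using (summable_geometric_of_lt_one (norm_nonneg _) hq).mul_right ‖w‖

lemma qProd_eq_mul {q : ℂ} (hq : ‖q‖ < 1) (w : ℂ) : qProd q w = (1 - w) * qProd q (q * w) := by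
  have e : ∀ n : ℕ, 1 + -(q ^ (n + 1) * w) = 1 + -(q ^ n * (q * w)) := fun n => by
    rw [pow_succ, mul_assoc]
  have h : Multipliable fun n : ℕ => 1 + -(q ^ (n + 1) * w) := by
    simp only [e]
    exact multipliable_one_add_of_summable (summable_norm_pow_mul hq (q * w))
  have h2 := tprod_eq_zero_mul' (f := fun n : ℕ => 1 + -(q ^ n * w)) h
  simp only [e, pow_zero, one_mul] at h2
  rw [qProd, qProd, h2, sub_eq_add_neg]

lemma qProd_eq_zero_iff {q : ℂ} (hq : ‖q‖ < 1) (w : ℂ) :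
    qProd q w = 0 ↔ ∃ n : ℕ, q ^ n * w = 1 := by
  constructor
  · contrapose!
    intro h
    refine tprod_one_add_ne_zero_of_summable (fun n hn => h n ?_) (summable_norm_pow_mul hq w)
    linear_combination -hn
  · rintro ⟨n, hn⟩
    induction n generalizing w with
    | zero => rw [qProd_eq_mul hq, show w = 1 by simpa using hn]; simp
    | succ n ih => rw [qProd_eq_mul hq, ih (q * w) (by rw [← hn]; ring), mul_zero]

lemma differentiable_qProd {q : ℂ} (hq : ‖q‖ < 1) : Differentiable ℂ (qProd q) := by
  intro w
  have hu : Summable fun n : ℕ => ‖q‖ ^ n * (‖w‖ + 1) :=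
    (summable_geometric_of_lt_one (norm_nonneg _) hq).mul_right _
  have h := Summable.hasProdLocallyUniformlyOn_nat_one_add (R := ℂ)
    (f := fun (n : ℕ) (x : ℂ) => -(q ^ n * x)) (K := Metric.ball 0 (‖w‖ + 1)) Metric.isOpen_ball hu
    (.of_forall fun n x hx => by
      have : ‖x‖ ≤ ‖w‖ + 1 := by simpa using (mem_ball_zero_iff.1 hx).le
      simp only [norm_neg, norm_mul, norm_pow]
      gcongr) (fun n => by fun_prop)
  have h2 : DifferentiableOn ℂ (qProd q) (Metric.ball 0 (‖w‖ + 1)) :=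
    h.differentiableOn (.of_forall fun _ => by
      simpa [Finset.prod_fn] using DifferentiableOn.finsetProd (fun _ _ => by fun_prop))
      Metric.isOpen_ball
  exact h2.differentiableAt (Metric.isOpen_ball.mem_nhds (by simp))

/-- The function `exp (2πi z)`. -/
def expTwoPiI (z : ℂ) : ℂ := exp (2 * Real.pi * I * z)

lemma expTwoPiI_add (z w : ℂ) : expTwoPiI (z + w) = expTwoPiI z * expTwoPiI w := by
  simp [expTwoPiI, mul_add, exp_add]

lemma expTwoPiI_nat_mul (n : ℕ) (z : ℂ) : expTwoPiI (n * z) = expTwoPiI z ^ n := by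
  rw [expTwoPiI, expTwoPiI, ← exp_nat_mul]; congr 1; ring

lemma expTwoPiI_eq_one_iff (z : ℂ) : expTwoPiI z = 1 ↔ ∃ n : ℤ, z = n := by
  rw [expTwoPiI, exp_eq_one_iff]
  refine exists_congr fun n => ?_
  rw [mul_comm (n : ℂ), mul_right_inj' two_pi_I_ne_zero]

lemma expTwoPiI_ne_zero (z : ℂ) : expTwoPiI z ≠ 0 := exp_ne_zero _

lemma expTwoPiI_half : expTwoPiI (1 / 2) = -1 := by
  rw [expTwoPiI, ← exp_pi_mul_I]; congr 1; ring

lemma hasDerivAt_expTwoPiI (z : ℂ) :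
    HasDerivAt expTwoPiI (expTwoPiI z * (2 * Real.pi * I)) z := by
  have := ((hasDerivAt_id z).const_mul (2 * Real.pi * I)).cexp
  rw [id, mul_one] at this
  exact this

lemma norm_expTwoPiI_lt_one {τ : ℂ} (hτ : 0 < τ.im) : ‖expTwoPiI τ‖ < 1 := by
  rw [expTwoPiI, norm_exp, Real.exp_lt_one_iff]
  simp
  positivity

/-- The product form of a theta function with simple zeros at `ℤ + ℤ τ`. -/
def thetaProd (τ z : ℂ) : ℂ :=
  qProd (expTwoPiI τ) (expTwoPiI z) * qProd (expTwoPiI τ) (expTwoPiI τ * expTwoPiI (-z))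

variable {τ : ℂ}

lemma differentiable_thetaProd (hτ : 0 < τ.im) : Differentiable ℂ (thetaProd τ) := by
  have h := differentiable_qProd (norm_expTwoPiI_lt_one hτ)
  have he : Differentiable ℂ expTwoPiI := fun z => (hasDerivAt_expTwoPiI z).differentiableAt
  exact (h.comp he).mul (h.comp ((he.comp differentiable_neg).const_mul _))

lemma thetaProd_add_one (z : ℂ) : thetaProd τ (z + 1) = thetaProd τ z := by
  have h1 : expTwoPiI 1 = 1 := (expTwoPiI_eq_one_iff _).2 ⟨1, by simp⟩
  have h2 : expTwoPiI (-1) = 1 := (expTwoPiI_eq_one_iff _).2 ⟨-1, by simp⟩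
  simp [thetaProd, expTwoPiI_add, neg_add, -neg_add_rev, h1, h2]

/-- The shift by `τ` removes the factor `1 - w`, `w = exp (2πi z)`, from the first product and adds
`1 - w⁻¹` to the second; their ratio is `-w⁻¹`, and the sign is the `1 / 2` in the exponent. -/
lemma thetaProd_add_period (hτ : 0 < τ.im) (z : ℂ) :
    thetaProd τ (z + τ) = expTwoPiI (-z + 1 / 2) * thetaProd τ z := by
  have hq := norm_expTwoPiI_lt_one hτ
  have h1 : expTwoPiI τ * expTwoPiI (-(z + τ)) = expTwoPiI (-z) := by
    rw [← expTwoPiI_add]; congr 1; ring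
  have h2 : expTwoPiI (z + τ) = expTwoPiI τ * expTwoPiI z := by rw [add_comm, expTwoPiI_add]
  have h3 : expTwoPiI (-z) * expTwoPiI z = 1 := by
    rw [← expTwoPiI_add]; simp [expTwoPiI]
  rw [thetaProd, thetaProd, h1, h2, qProd_eq_mul hq (expTwoPiI z), qProd_eq_mul hq (expTwoPiI (-z)),
    expTwoPiI_add, expTwoPiI_half]
  linear_combination (- qProd (expTwoPiI τ) (expTwoPiI τ * expTwoPiI z) *
    qProd (expTwoPiI τ) (expTwoPiI τ * expTwoPiI (-z))) * h3

lemma thetaProd_add_int (p : ℤ) (z : ℂ) : thetaProd τ (z + p) = thetaProd τ z := by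
  have : Function.Periodic (thetaProd τ) 1 := thetaProd_add_one
  simpa using this.int_mul p z

lemma exists_thetaProd_add_int_mul (hτ : 0 < τ.im) (q : ℤ) :
    ∃ c : ℂ, ∀ z, thetaProd τ (z + q * τ) = expTwoPiI (-q * z + c) * thetaProd τ z := by
  induction q using Int.induction_on with
  | zero => exact ⟨0, fun z => by simp [expTwoPiI]⟩
  | succ n ih =>
    obtain ⟨c, hc⟩ := ih
    refine ⟨c + 1 / 2 - n * τ, fun z => ?_⟩
    have := hc (z + τ)
    rw [thetaProd_add_period hτ, ← mul_assoc, ← expTwoPiI_add] at this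
    rw [show z + ((n : ℤ) + 1 : ℤ) * τ = z + τ + (n : ℤ) * τ by push_cast; ring, this]
    congr 2; push_cast; ring
  | pred n ih =>
    obtain ⟨c, hc⟩ := ih
    refine ⟨c - n * τ - τ - 1 / 2, fun z => ?_⟩
    have h1 := hc (z - τ)
    have h2 := thetaProd_add_period hτ (z - τ)
    rw [sub_add_cancel] at h2
    rw [h2, ← mul_assoc, ← expTwoPiI_add]
    rw [show z + (-(n : ℤ) - 1 : ℤ) * τ = z - τ + (-(n : ℤ) : ℤ) * τ by push_cast; ring, h1]
    congr 2; push_cast; ring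

lemma thetaProd_eq_zero_iff (hτ : 0 < τ.im) (z : ℂ) :
    thetaProd τ z = 0 ↔ ∃ p q : ℤ, z = p + q * τ := by
  have hq := norm_expTwoPiI_lt_one hτ
  rw [thetaProd, mul_eq_zero, qProd_eq_zero_iff hq, qProd_eq_zero_iff hq]
  simp only [← expTwoPiI_nat_mul, ← expTwoPiI_add, expTwoPiI_eq_one_iff]
  constructor
  · rintro (⟨n, p, h⟩ | ⟨n, p, h⟩)
    · exact ⟨p, -n, by push_cast; linear_combination h⟩
    · exact ⟨-p, n + 1, by push_cast; linear_combination -h⟩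
  · rintro ⟨p, q, h⟩
    rcases le_or_gt q 0 with hq | hq
    · obtain ⟨n, hn⟩ := Int.eq_ofNat_of_zero_le (neg_nonneg.2 hq)
      obtain rfl : q = -n := by omega
      exact Or.inl ⟨n, p, by rw [h]; push_cast; ring⟩
    · obtain ⟨n, hn⟩ := Int.eq_ofNat_of_zero_le (show 0 ≤ q - 1 by omega)
      obtain rfl : q = n + 1 := by omega
      exact Or.inr ⟨n, -p, by rw [h]; push_cast; ring⟩

/-- Only the factor `1 - exp (2πi z)` vanishes at 0, and to first order; the cofactor `R` is there a
square of `∏ (1 - qⁿ)` over `n ≥ 1`, nonzero as `|q| < 1`. -/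
lemma deriv_thetaProd_zero_ne_zero (hτ : 0 < τ.im) : deriv (thetaProd τ) 0 ≠ 0 := by
  have hq := norm_expTwoPiI_lt_one hτ
  have hd := differentiable_qProd hq
  have he : Differentiable ℂ expTwoPiI := fun z => (hasDerivAt_expTwoPiI z).differentiableAt
  set R : ℂ → ℂ := fun z => qProd (expTwoPiI τ) (expTwoPiI τ * expTwoPiI z) *
    qProd (expTwoPiI τ) (expTwoPiI τ * expTwoPiI (-z)) with hR
  have hRd : Differentiable ℂ R :=
    (hd.comp (he.const_mul _)).mul (hd.comp ((he.comp differentiable_neg).const_mul _))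
  have h0 : expTwoPiI 0 = 1 := by simp [expTwoPiI]
  have hS : thetaProd τ = fun z => (1 - expTwoPiI z) * R z := by
    funext z
    rw [thetaProd, qProd_eq_mul hq (expTwoPiI z), hR]; ring
  have hR0 : R 0 ≠ 0 := by
    simp only [hR, neg_zero, h0, mul_one]
    have : qProd (expTwoPiI τ) (expTwoPiI τ) ≠ 0 := by
      rw [Ne, qProd_eq_zero_iff hq]
      rintro ⟨n, hn⟩
      rw [← pow_succ] at hn
      have := congrArg norm hn
      rw [norm_pow, norm_one] at this
      exact (pow_lt_one₀ (norm_nonneg _) hq (by omega)).ne this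
    exact mul_ne_zero this this
  have h := ((hasDerivAt_expTwoPiI 0).const_sub 1).mul (hRd 0).hasDerivAt
  rw [hS]
  have h' : HasDerivAt (fun z => (1 - expTwoPiI z) * R z) (-(2 * Real.pi * I) * R 0) 0 := by
    refine h.congr_deriv ?_
    rw [h0]; ring
  rw [h'.deriv]
  exact mul_ne_zero (neg_ne_zero.2 two_pi_I_ne_zero) hR0

/-- Quasi-periodicity carries the simple zero at 0 to every other zero. -/
lemma deriv_thetaProd_ne_zero (hτ : 0 < τ.im) {z : ℂ} (hz : thetaProd τ z = 0) :
    deriv (thetaProd τ) z ≠ 0 := by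
  obtain ⟨p, q, rfl⟩ := (thetaProd_eq_zero_iff hτ z).1 hz
  obtain ⟨c, hc⟩ := exists_thetaProd_add_int_mul hτ q
  have h0 : thetaProd τ 0 = 0 := (thetaProd_eq_zero_iff hτ 0).2 ⟨0, 0, by simp⟩
  have hd := differentiable_thetaProd hτ
  have h1 : (fun z => thetaProd τ (z + (p + q * τ))) =
      fun z => expTwoPiI (-q * z + c) * thetaProd τ z := by
    funext z
    rw [← hc, ← thetaProd_add_int p (z + q * τ)]; congr 1; ring
  have h2 := congrArg (fun f => deriv f 0) h1
  simp only [deriv_comp_add_const, zero_add] at h2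
  have h3 : HasDerivAt (fun z : ℂ => -q * z + c) (-q) 0 := by
    simpa using ((hasDerivAt_id (0 : ℂ)).const_mul (-q : ℂ)).add_const c
  have h4 := ((hasDerivAt_expTwoPiI _).comp 0 h3).mul (hd 0).hasDerivAt
  rw [h2, show (fun z => expTwoPiI (-q * z + c) * thetaProd τ z) =
    (expTwoPiI ∘ fun z => -q * z + c) * thetaProd τ from rfl, h4.deriv, h0, mul_zero, zero_add]
  exact mul_ne_zero (expTwoPiI_ne_zero _) (deriv_thetaProd_zero_ne_zero hτ)

lemma mem_lattice_iff_int (L : PeriodPair) (z : ℂ) :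
    z ∈ L.lattice ↔ ∃ p q : ℤ, z = p * L.ω₁ + q * L.ω₂ := by
  rw [PeriodPair.mem_lattice]
  simp only [eq_comm]

lemma ω₁_ne_zero (L : PeriodPair) : L.ω₁ ≠ 0 := L.indep.ne_zero 0

lemma im_div_ne_zero (L : PeriodPair) : (L.ω₂ / L.ω₁).im ≠ 0 := by
  intro h
  have h1 : L.ω₂ = ((L.ω₂ / L.ω₁).re : ℂ) * L.ω₁ := by
    rw [show ((L.ω₂ / L.ω₁).re : ℂ) = L.ω₂ / L.ω₁ from Complex.ext (by simp) (by simp [h]),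
      div_mul_cancel₀ _ (ω₁_ne_zero L)]
  have h2 := LinearIndependent.pair_iff.1 L.indep (L.ω₂ / L.ω₁).re (-1) (by
    rw [real_smul, ← h1]; simp)
  simp at h2

/-- There is an entire function with simple zeros exactly at the lattice points that is
quasi-periodic with exponential factors. -/
theorem exists_quasiperiodic (L : PeriodPair) :
    ∃ (s : ℂ → ℂ) (ε : ℤ) (κ : ℂ) (c : ℤ → ℂ), Differentiable ℂ s ∧
      (∀ z, s z = 0 ↔ z ∈ L.lattice) ∧ (∀ z ∈ L.lattice, deriv s z ≠ 0) ∧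
      ε * ε = 1 ∧ κ * L.ω₁ = ε ∧
      ∀ (p q : ℤ) (z : ℂ), s (z + (p * L.ω₁ + q * L.ω₂)) =
        exp (2 * Real.pi * I * (κ * q * z + c q)) * s z := by
  have hω := ω₁_ne_zero L
  -- The sign `δ` records the orientation of `(ω₁, ω₂)`. In the coordinate `z / ω₁` a shift by `q
  -- ω₂` is one by `q δ τ`, whence `κ = -δ / ω₁` and `ε = -δ`.
  obtain ⟨δ, hδ, hτ⟩ : ∃ δ : ℤ, δ * δ = 1 ∧ 0 < ((δ : ℂ) * (L.ω₂ / L.ω₁)).im := by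
    rcases (im_div_ne_zero L).lt_or_gt with h | h
    · exact ⟨-1, by norm_num, by simpa using h⟩
    · exact ⟨1, by norm_num, by simpa using h⟩
  have hδ' : (δ : ℂ) * δ = 1 := by exact_mod_cast hδ
  set τ := (δ : ℂ) * (L.ω₂ / L.ω₁) with hτdef
  have hω₂ : L.ω₂ = δ * τ * L.ω₁ := by
    rw [hτdef, ← mul_assoc, hδ', one_mul, div_mul_cancel₀ _ hω]
  choose c hc using fun q => exists_thetaProd_add_int_mul hτ q
  have hz : ∀ z, thetaProd τ (z / L.ω₁) = 0 ↔ z ∈ L.lattice := fun z => by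
    rw [thetaProd_eq_zero_iff hτ, mem_lattice_iff_int]
    constructor
    · rintro ⟨p, q, h⟩
      refine ⟨p, q * δ, ?_⟩
      rw [div_eq_iff hω] at h
      rw [h, hω₂]; push_cast
      linear_combination (-q * τ * L.ω₁) * hδ'
    · rintro ⟨p, q, rfl⟩
      refine ⟨p, q * δ, ?_⟩
      rw [div_eq_iff hω, hω₂]; push_cast; ring
  refine ⟨fun z => thetaProd τ (z / L.ω₁), -δ, -δ / L.ω₁, fun q => c (q * δ),
    (differentiable_thetaProd hτ).comp (differentiable_id.div_const _), hz, fun z hzL => ?_,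
    by linarith, by rw [div_mul_cancel₀ _ hω]; push_cast; rfl, fun p q z => ?_⟩
  · have := (differentiable_thetaProd hτ (z / L.ω₁)).hasDerivAt.comp z
      ((hasDerivAt_id z).div_const L.ω₁)
    rw [show (fun z => thetaProd τ (z / L.ω₁)) = thetaProd τ ∘ fun z => id z / L.ω₁ from rfl,
      this.deriv]
    exact mul_ne_zero (deriv_thetaProd_ne_zero hτ ((hz z).2 hzL)) (by simp [hω])
  · have h := hc (q * δ) (z / L.ω₁)
    rw [← thetaProd_add_int p (_ + _), expTwoPiI] at h
    convert h using 2
    · rw [hω₂]; push_cast; field_simp; ring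
    · push_cast; congr 1; ring

end Theta


/-! ### Independence of the Chern form from choices -/

section Uniqueness

open Complex

/-- Cancels a theta function even at its zeros, by continuity from nearby points where it does not
vanish. -/
lemma eventually_eq_of_frequently_ne_zero {X : Type*} [TopologicalSpace X] {f g ϑ : X → ℂ} {v : X}
    (hf : ContinuousAt f v) (hg : ContinuousAt g v) (hϑ : ∃ᶠ w in 𝓝 v, ϑ w ≠ 0)
    (h : ∀ᶠ w in 𝓝 v, ϑ w * f w = ϑ w * g w) : f v = g v := by
  by_contra hne
  obtain ⟨w, h1, h2, h3⟩ := (hϑ.and_eventually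
    (h.and ((hf.sub hg).eventually_ne (sub_ne_zero.2 hne)))).exists
  exact h3 (sub_eq_zero.2 (mul_left_cancel₀ h1 h2))

lemma IsThetaFunction.frequently_ne_zero {L : PeriodPair} {C : Set (Curve L × Curve L)}
    {ϑ : ℂ × ℂ → ℂ} (h : IsThetaFunction L C ϑ) (v : ℂ × ℂ) : ∃ᶠ w in 𝓝 v, ϑ w ≠ 0 := by
  intro H
  simp only [not_not] at H
  refine h.2.1 (AnalyticOnNhd.eq_of_eventuallyEq (fun v _ => h.1 v)
    (fun v _ => analyticAt_const) (z₀ := v) H)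

/-- Two theta functions of the same curve differ by a continuous nowhere vanishing factor. -/
lemma IsThetaFunction.exists_factor {L : PeriodPair} {C : Set (Curve L × Curve L)}
    {ϑ ϑ' : ℂ × ℂ → ℂ} (h : IsThetaFunction L C ϑ) (h' : IsThetaFunction L C ϑ') :
    ∃ u : ℂ × ℂ → ℂ, Continuous u ∧ (∀ v, u v ≠ 0) ∧ ∀ v, ϑ' v = ϑ v * u v := by
  -- Each function generates the ideal that contains the other. The local quotients `k v` agree
  -- where they overlap, so `v ↦ k v v` is locally one of them.
  choose k hk hk' using fun v => h.2.2.2 v ϑ' (h'.1 v) (.of_forall fun w => h'.2.2.1 w)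
  choose j hj hj' using fun v => h'.2.2.2 v ϑ (h.1 v) (.of_forall fun w => h.2.2.1 w)
  refine ⟨fun v => k v v, ?_, fun v => ?_, fun v => (hk' v).self_of_nhds⟩
  · rw [continuous_iff_continuousAt]
    intro v
    refine (hk v).continuousAt.congr ?_
    filter_upwards [(hk v).eventually_analyticAt, (hk' v).eventually_nhds] with w hw hw'
    refine eventually_eq_of_frequently_ne_zero hw.continuousAt (hk w).continuousAt
      (h.frequently_ne_zero w) ?_
    filter_upwards [hw', hk' w] with x hx hx'
    rw [← hx, hx']
  · have : k v v * j v v = 1 := by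
      refine eventually_eq_of_frequently_ne_zero (f := fun w => k v w * j v w) (g := fun _ => 1)
        ((hk v).continuousAt.mul (hj v).continuousAt) continuousAt_const (h.frequently_ne_zero v) ?_
      filter_upwards [hk' v, hj' v] with w h1 h2
      rw [← mul_assoc, ← h1, ← h2, mul_one]
    exact left_ne_zero_of_mul_eq_one this

lemma exists_continuous_log {X : Type*} [TopologicalSpace X] [SimplyConnectedSpace X]
    [LocallyPathConnectedSpace X] {u : X → ℂ} (hu : Continuous u) (h0 : ∀ x, u x ≠ 0) :
    ∃ ℓ : X → ℂ, Continuous ℓ ∧ ∀ x, u x = exp (2 * Real.pi * I * ℓ x) := by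
  obtain ⟨x⟩ : Nonempty X := inferInstance
  obtain ⟨F, ⟨-, hF⟩, -⟩ := isCoveringMapOn_exp.existsUnique_continuousMap_lifts ⟨u, hu⟩
    (a₀ := x) (e₀ := log (u x)) (exp_log (h0 x)) (fun a => by simpa using h0 a)
  refine ⟨fun y => F y / (2 * Real.pi * I), by fun_prop, fun y => ?_⟩
  rw [mul_div_cancel₀ _ two_pi_I_ne_zero]
  exact (congrFun hF y).symm

/-- A continuous function on a connected space with values in `ℤ` is constant. -/
lemma exists_eq_const_of_exp_eq_one {X : Type*} [TopologicalSpace X] [PreconnectedSpace X]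
    [Nonempty X] {f : X → ℂ} (hf : Continuous f)
    (h : ∀ x, exp (2 * Real.pi * I * f x) = 1) : ∃ c, ∀ x, f x = c := by
  have h1 : ∀ x, ∃ n : ℤ, f x = n := fun x => by
    obtain ⟨n, hn⟩ := exp_eq_one_iff.1 (h x)
    refine ⟨n, ?_⟩
    rwa [mul_comm (n : ℂ), mul_right_inj' two_pi_I_ne_zero] at hn
  choose n hn using h1
  have hc : Continuous n := by
    refine Int.isClosedEmbedding_coe_real.isEmbedding.continuous_iff.2 ?_
    have : (fun x => ((n x : ℤ) : ℝ)) = fun x => (f x).re := by funext x; rw [hn]; simp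
    show Continuous fun x => ((n x : ℤ) : ℝ)
    rw [this]; fun_prop
  obtain ⟨x⟩ := ‹Nonempty X›
  exact ⟨n x, fun y => by rw [hn, PreconnectedSpace.constant ‹_› hc (x := y) (y := x)]⟩

/-- The Chern form of a curve is unique. -/
theorem IsChernForm.unique {L : PeriodPair} {C : Set (Curve L × Curve L)}
    {A B : L.lattice × L.lattice → L.lattice × L.lattice → ℤ}
    (hA : IsChernForm L C A) (hB : IsChernForm L C B) : A = B := by
  obtain ⟨ϑ, g, hϑ, hg, hgϑ, hgA⟩ := hA
  obtain ⟨ϑ', g', hϑ', hg', hgϑ', hgB⟩ := hB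
  obtain ⟨u, hu, hu0, huϑ⟩ := hϑ.exists_factor hϑ'
  obtain ⟨ℓ, hℓ, hℓu⟩ := exists_continuous_log hu hu0
  have hcont : ∀ m, Continuous fun v => g' m v - g m v - ℓ (v + period L m) + ℓ v := fun m => by
    have := hg m
    have := hg' m
    fun_prop
  -- Two systems of logarithms differ by the coboundary of `ℓ` and an integer constant for each `m`;
  -- both drop out of the antisymmetrized expression for the form.
  have key : ∀ m, ∃ c, ∀ v, g' m v - g m v - ℓ (v + period L m) + ℓ v = c := by
    intro m
    refine exists_eq_const_of_exp_eq_one (hcont m) fun v => ?_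
    refine eventually_eq_of_frequently_ne_zero (ϑ := ϑ)
      (f := fun v => exp (2 * Real.pi * I * (g' m v - g m v - ℓ (v + period L m) + ℓ v)))
      (g := fun _ => 1) ?_ continuousAt_const (hϑ.frequently_ne_zero v) (.of_forall fun w => ?_)
    · exact (continuous_exp.comp (continuous_const.mul (hcont m))).continuousAt
    · have h1 := hgϑ' m w
      rw [huϑ, huϑ, hgϑ, hℓu, hℓu] at h1
      have e : 2 * Real.pi * I * (g' m w - g m w - ℓ (w + period L m) + ℓ w) =
        2 * Real.pi * I * g' m w + 2 * Real.pi * I * ℓ w - (2 * Real.pi * I * g m w +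
          2 * Real.pi * I * ℓ (w + period L m)) := by ring
      rw [e, exp_sub, exp_add, exp_add, mul_one]
      field_simp
      linear_combination -h1
  choose c hc using key
  funext m n
  have h : (A m n : ℂ) = B m n := by
    rw [hgA m n 0, hgB m n 0]
    have e : (0 : ℂ × ℂ) + period L m + period L n = 0 + period L n + period L m := by abel
    have h1 := hc n (0 + period L m)
    rw [e] at h1
    linear_combination hc m (0 + period L n) + hc n 0 - h1 - hc m 0
  exact_mod_cast h

lemma IsChernForm.chernForm_eq {L : PeriodPair} {C : Set (Curve L × Curve L)}
    {A : L.lattice × L.lattice → L.lattice × L.lattice → ℤ} (hA : IsChernForm L C A) :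
    chernForm L C = A := by
  have h : ∃ A, IsChernForm L C A := ⟨A, hA⟩
  rw [chernForm, dif_pos h]
  exact h.choose_spec.unique hA

end Uniqueness


/-! ### Holomorphic endomorphisms as multiplications -/

section Endomorphisms

open Complex

variable {L : PeriodPair}

lemma proj_eq_iff {z w : ℂ} : proj L z = proj L w ↔ z - w ∈ L.lattice := Submodule.Quotient.eq _

lemma proj_add (z w : ℂ) : proj L (z + w) = proj L z + proj L w := rfl

lemma proj_sub (z w : ℂ) : proj L (z - w) = proj L z - proj L w := rfl

lemma proj_zsmul (n : ℤ) (z : ℂ) : proj L (n * z) = n • proj L z := by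
  rw [← zsmul_eq_mul]; rfl

lemma eventually_mem_lattice_imp_eq (z : ℂ) : ∀ᶠ w in 𝓝 z, w ∈ L.lattice → w = z := by
  filter_upwards [L.compl_lattice_sdiff_singleton_mem_nhds z] with w hw hwL
  by_contra hne
  exact hw ⟨hwL, hne⟩

/-- A differentiable function that is additive near the origin is linear there. -/
lemma eventually_eq_mul_of_eventually_add {G : ℂ → ℂ} (hG : DifferentiableAt ℂ G 0)
    (hG0 : G 0 = 0) (hadd : ∀ᶠ z in 𝓝 (0 : ℂ), ∀ᶠ w in 𝓝 (0 : ℂ), G (z + w) = G z + G w) :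
    ∀ᶠ z in 𝓝 (0 : ℂ), G z = deriv G 0 * z := by
  -- Additivity transports the derivative at 0 to every nearby point.
  have hd : ∀ᶠ z in 𝓝 (0 : ℂ), HasDerivAt G (deriv G 0) z := by
    filter_upwards [hadd] with z hz
    have h1 : HasDerivAt (fun w => G (z + w)) (deriv G 0) 0 :=
      (hG.hasDerivAt.const_add (G z)).congr_of_eventuallyEq hz
    have h2 : HasDerivAt (fun w => G (z + w)) (deriv G 0) (z - z) := by rwa [sub_self]
    have h3 := h2.comp_sub_const z z
    simpa using h3
  obtain ⟨r, hr, hball⟩ := Metric.eventually_nhds_iff_ball.1 hd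
  filter_upwards [Metric.ball_mem_nhds 0 hr] with z hz
  refine Metric.isOpen_ball.eqOn_of_deriv_eq (𝕜 := ℂ) (s := Metric.ball (0 : ℂ) r)
    (f := G) (g := fun z => deriv G 0 * z)
    (convex_ball _ _).isPreconnected
    (fun w hw => (hball w hw).differentiableAt.differentiableWithinAt)
    (by fun_prop) (fun w hw => ?_) (Metric.mem_ball_self hr) (by simp [hG0]) hz
  rw [(hball w hw).deriv]
  simp

/-- A holomorphic endomorphism of `ℂ / Λ` lifts to multiplication by a complex number. -/
theorem exists_multiplier (φ : endRing L) : ∃ α : ℂ, ∀ z, φ.1 (proj L z) = proj L (α * z) := by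
  obtain ⟨g, hg, hgφ⟩ := φ.2 0
  have hg0 : proj L (g 0) = 0 := by
    rw [← hgφ.self_of_nhds]; exact map_zero φ.1
  set G : ℂ → ℂ := fun z => g z - g 0 with hG
  have hGφ : ∀ᶠ w in 𝓝 0, φ.1 (proj L w) = proj L (G w) := by
    filter_upwards [hgφ] with w hw
    rw [hG, proj_sub, hg0, sub_zero, ← hw]
  have hGc : ContinuousAt G 0 := hg.continuousAt.sub continuousAt_const
  have hG0 : G 0 = 0 := sub_self _
  have hadd : ∀ᶠ z in 𝓝 (0 : ℂ), ∀ᶠ w in 𝓝 (0 : ℂ), G (z + w) = G z + G w := by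
    suffices h : ∀ᶠ x : ℂ × ℂ in 𝓝 (0, 0), G (x.1 + x.2) = G x.1 + G x.2 by
      rw [nhds_prod_eq] at h
      exact h.curry
    have t1 : Filter.Tendsto (fun x : ℂ × ℂ => x.1) (𝓝 (0, 0)) (𝓝 0) := continuousAt_fst
    have t2 : Filter.Tendsto (fun x : ℂ × ℂ => x.2) (𝓝 (0, 0)) (𝓝 0) := continuousAt_snd
    have t3 : Filter.Tendsto (fun x : ℂ × ℂ => x.1 + x.2) (𝓝 (0, 0)) (𝓝 0) := by
      simpa using t1.add t2
    have hGt : Filter.Tendsto G (𝓝 0) (𝓝 0) := by simpa [ContinuousAt, hG0] using hGc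
    have t4 : Filter.Tendsto (fun x : ℂ × ℂ => G (x.1 + x.2) - (G x.1 + G x.2))
        (𝓝 (0, 0)) (𝓝 0) := by
      simpa using (hGt.comp t3).sub ((hGt.comp t1).add (hGt.comp t2))
    filter_upwards [t1.eventually hGφ, t2.eventually hGφ, t3.eventually hGφ,
      t4.eventually (eventually_mem_lattice_imp_eq (L := L) 0)] with x h1 h2 h3 h4
    -- The defect of additivity of the lift is a lattice point close to 0, hence 0 by discreteness.
    refine sub_eq_zero.1 (h4 ?_)
    rw [← proj_eq_iff, proj_add, ← h1, ← h2, ← h3, proj_add, map_add]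
  have hlin := eventually_eq_mul_of_eventually_add
    (hg.differentiableAt.sub_const _) hG0 hadd
  refine ⟨deriv G 0, fun z => ?_⟩
  -- The formula holds near 0; it extends to `z` as `φ` is additive and `z / n` is small.
  have ht : Filter.Tendsto (fun n : ℕ => z / (n : ℂ)) Filter.atTop (𝓝 0) :=
    tendsto_const_div_atTop_nhds_zero_nat z
  obtain ⟨n, h1, h2, hn⟩ := ((ht.eventually hGφ).and ((ht.eventually hlin).and
    (Filter.eventually_gt_atTop 0))).exists
  have hn' : (n : ℂ) ≠ 0 := by exact_mod_cast hn.ne'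
  have e1 : z = ((n : ℤ) : ℂ) * (z / n) := by push_cast; field_simp
  have e2 : deriv G 0 * z = ((n : ℤ) : ℂ) * (deriv G 0 * (z / n)) := by push_cast; field_simp
  rw [e2, proj_zsmul, ← h2, ← h1, ← map_zsmul, ← proj_zsmul, ← e1]

lemma mul_mem_lattice_of_multiplier {φ : endRing L} {α : ℂ}
    (hα : ∀ z, φ.1 (proj L z) = proj L (α * z)) {z : ℂ} (hz : z ∈ L.lattice) :
    α * z ∈ L.lattice := by
  have h0 : proj L z = proj L 0 := proj_eq_iff.2 (by simpa using hz)
  have h1 := hα z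
  rw [h0, hα 0, proj_eq_iff] at h1
  simpa using neg_mem h1

/-- The multiplier satisfies the integral quadratic equations that the endomorphism satisfies. -/
lemma multiplier_sq {φ : endRing L} {α : ℂ} (hα : ∀ z, φ.1 (proj L z) = proj L (α * z)) {t n : ℤ}
    (h : φ * φ = t • φ - n • (1 : endRing L)) : α * α = t * α - n := by
  have key : ∀ z, (α * α - (t * α - n)) * z ∈ L.lattice := fun z => by
    have h1 := congrArg (fun ψ : endRing L => ψ.1 (proj L z)) h
    have h2 : φ.1 (φ.1 (proj L z)) = t • φ.1 (proj L z) - n • proj L z := h1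
    rw [hα, hα, ← proj_zsmul, ← proj_zsmul, ← proj_sub, proj_eq_iff] at h2
    convert h2 using 1; ring
  -- A nonzero constant would scale all of `ℂ` into the lattice, which misses `ω₁ / 2`.
  by_contra hne
  refine L.ω₁_div_two_notMem_lattice ?_
  have := key ((α * α - (t * α - n))⁻¹ * (L.ω₁ / 2))
  rwa [mul_inv_cancel_left₀ (sub_ne_zero.2 hne)] at this

end Endomorphisms


/-! ### Chern forms of the curves and their pairings -/

section ChernForms

open Complex

variable {L : PeriodPair}

lemma exists_eq_sub_mul_deriv {s : ℂ → ℂ} (hs : Differentiable ℂ s) {a : ℂ} (ha : s a = 0) :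
    ∃ u : ℂ → ℂ, AnalyticAt ℂ u a ∧ u a = deriv s a ∧ ∀ z, s z = (z - a) * u z := by
  obtain ⟨p, hp⟩ := hs.analyticAt a
  refine ⟨dslope s a, ⟨_, hp.has_fpower_series_dslope_fslope⟩, dslope_same _ _, fun z => ?_⟩
  have := sub_smul_dslope s a z
  rw [ha, sub_zero, smul_eq_mul] at this
  exact this.symm

/-- A function of one variable with simple zeros at the lattice, composed with a linear form, is a
theta function. -/
lemma isThetaFunction_comp {s : ℂ → ℂ} (hs : Differentiable ℂ s)
    (hs0 : ∀ z, s z = 0 ↔ z ∈ L.lattice) (hs1 : ∀ z ∈ L.lattice, deriv s z ≠ 0)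
    {l : ℂ × ℂ →L[ℂ] ℂ} (hl : l ≠ 0) {C : Set (Curve L × Curve L)}
    (hC : ∀ v, proj₂ L v ∈ C ↔ l v ∈ L.lattice) :
    IsThetaFunction L C (fun v => s (l v)) := by
  have han : ∀ v, AnalyticAt ℂ (fun v => s (l v)) v := fun v =>
    (hs.analyticAt (l v)).fun_comp (l.analyticAt v)
  refine ⟨han, fun h => ?_, fun v hv => (hs0 _).2 ((hC v).1 hv), fun v f hf hf0 => ?_⟩
  · obtain ⟨e, he⟩ : ∃ e, l e ≠ 0 := by
      by_contra! H
      exact hl (ContinuousLinearMap.ext H)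
    have h1 := congrFun h ((L.ω₁ / 2 / l e) • e)
    simp only [map_smul, smul_eq_mul, div_mul_cancel₀ _ he, Pi.zero_apply] at h1
    exact L.ω₁_div_two_notMem_lattice ((hs0 _).1 h1)
  · by_cases hv : l v ∈ L.lattice
    · obtain ⟨h, hh, hfh⟩ := exists_eq_sub_mul_of_eq_zero hf l hl (by
        filter_upwards [hf0] with w hw hlw
        exact hw ((hC w).2 (hlw ▸ hv)))
      obtain ⟨u, hu, hu0, hsu⟩ := exists_eq_sub_mul_deriv hs ((hs0 _).2 hv)
      have hul : AnalyticAt ℂ (fun w => u (l w)) v := hu.fun_comp (l.analyticAt v)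
      have hne : u (l v) ≠ 0 := hu0 ▸ hs1 _ hv
      refine ⟨fun w => h w / u (l w), hh.fun_div hul hne, ?_⟩
      filter_upwards [hfh, hul.continuousAt.eventually_ne hne] with w h1 h2
      rw [h1, hsu]
      field_simp
    · have hne : s (l v) ≠ 0 := fun h => hv ((hs0 _).1 h)
      refine ⟨fun w => f w / s (l w), hf.fun_div (han v) hne, ?_⟩
      filter_upwards [(han v).continuousAt.eventually_ne hne] with w hw
      field_simp

/-- The Chern form of the curve that a linear form `l` cuts out is the pullback along `l` of an
alternating form on the lattice of discriminant one. -/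
theorem exists_chernForm_eq (L : PeriodPair) :
    ∃ ε : ℤ, ε * ε = 1 ∧ ∀ (l : ℂ × ℂ →L[ℂ] ℂ) (C : Set (Curve L × Curve L)), l ≠ 0 →
      (∀ v, proj₂ L v ∈ C ↔ l v ∈ L.lattice) → ∀ p q : L.lattice × L.lattice → ℤ,
      (∀ m, l (period L m) = p m * L.ω₁ + q m * L.ω₂) →
      chernForm L C = fun m n => ε * (p m * q n - q m * p n) := by
  obtain ⟨s, ε, κ, c, hs, hs0, hs1, hε, hκ, hper⟩ := exists_quasiperiodic L
  refine ⟨ε, hε, fun l C hl hC p q hpq => IsChernForm.chernForm_eq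
    ⟨fun v => s (l v), fun m v => κ * q m * l v + c (q m), isThetaFunction_comp hs hs0 hs1 hl hC,
      fun m => by fun_prop, fun m v => ?_, fun m n v => ?_⟩⟩
  · simp only [map_add, hpq, hper]
  -- The constants `c` cancel, leaving `κ (q n * l m - q m * l n)`; its `ω₂` terms cancel too, and
  -- `κ ω₁ = ε`.
  · push_cast
    rw [map_add, map_add, hpq, hpq, ← hκ]
    ring

/-- The first integral coordinate of a lattice point. -/
def coord₁ (L : PeriodPair) (m : L.lattice) : ℤ := (L.latticeEquivProd m).1

/-- The second integral coordinate of a lattice point. -/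
def coord₂ (L : PeriodPair) (m : L.lattice) : ℤ := (L.latticeEquivProd m).2

lemma coe_eq_coord (m : L.lattice) : (m : ℂ) = coord₁ L m * L.ω₁ + coord₂ L m * L.ω₂ := by
  have := L.latticeEquiv_symm_apply (L.latticeEquivProd m)
  rw [LinearEquiv.symm_apply_apply] at this
  exact this

lemma latticeEquivProd_eq {m : L.lattice} {p q : ℤ} (h : (m : ℂ) = p * L.ω₁ + q * L.ω₂) :
    L.latticeEquivProd m = (p, q) := by
  rw [← LinearEquiv.eq_symm_apply]
  exact Subtype.ext (h.trans (L.latticeEquiv_symm_apply (p, q)).symm)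

@[simp] lemma latticeEquivProd_ω₁ (h : L.ω₁ ∈ L.lattice) : L.latticeEquivProd ⟨L.ω₁, h⟩ = (1, 0) :=
  latticeEquivProd_eq (by simp)

@[simp] lemma latticeEquivProd_ω₂ (h : L.ω₂ ∈ L.lattice) : L.latticeEquivProd ⟨L.ω₂, h⟩ = (0, 1) :=
  latticeEquivProd_eq (by simp)

/-- Multiplication by `α` has determinant `|α|²` on a lattice that it preserves. -/
lemma det_eq_norm_sq {α : ℂ} {a b c d : ℤ} (h₁ : α * L.ω₁ = a * L.ω₁ + b * L.ω₂)
    (h₂ : α * L.ω₂ = c * L.ω₁ + d * L.ω₂) : ((a * d - b * c : ℤ) : ℝ) = ‖α‖ ^ 2 := by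
  have hD : L.ω₁.re * L.ω₂.im - L.ω₁.im * L.ω₂.re ≠ 0 := by
    intro h
    apply im_div_ne_zero L
    rw [div_im]
    linear_combination h / normSq L.ω₁
  apply mul_right_cancel₀ hD
  rw [← normSq_eq_norm_sq, normSq_apply]
  have r1 := congrArg re h₁
  have i1 := congrArg im h₁
  have r2 := congrArg re h₂
  have i2 := congrArg im h₂
  simp at r1 i1 r2 i2
  push_cast
  set x := L.ω₁.re
  set y := L.ω₁.im
  set z := L.ω₂.re
  set w := L.ω₂.im
  have e : (α.re * x - α.im * y) * (α.re * w + α.im * z) -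
      (α.re * y + α.im * x) * (α.re * z - α.im * w) =
    (a * x + b * z) * (c * y + d * w) - (a * y + b * w) * (c * x + d * z) := by
    rw [r1, i1, r2, i2]
  linear_combination -e

/-- The alternating form of the graph of an endomorphism with matrix `(a, b; c, d)`. -/
def graphForm (L : PeriodPair) (ε a b c d : ℤ) (m n : L.lattice × L.lattice) : ℤ :=
  let p (m : L.lattice × L.lattice) := coord₁ L m.2 - a * coord₁ L m.1 - c * coord₂ L m.1
  let q (m : L.lattice × L.lattice) := coord₂ L m.2 - b * coord₁ L m.1 - d * coord₂ L m.1
  ε * (p m * q n - q m * p n)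

/-- The alternating form of `{0} × E`. -/
def fibreForm (L : PeriodPair) (ε : ℤ) (m n : L.lattice × L.lattice) : ℤ :=
  ε * (coord₁ L m.1 * coord₂ L n.1 - coord₂ L m.1 * coord₁ L n.1)

lemma exists_chernForm_eq_graphForm (L : PeriodPair) :
    ∃ ε : ℤ, ε * ε = 1 ∧ chernForm L (fibre₁ L) = fibreForm L ε ∧
      ∀ (C : Set (Curve L × Curve L)) (α : ℂ) (a b c d : ℤ),
      (∀ v, proj₂ L v ∈ C ↔ v.2 - α * v.1 ∈ L.lattice) →
      α * L.ω₁ = a * L.ω₁ + b * L.ω₂ → α * L.ω₂ = c * L.ω₁ + d * L.ω₂ →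
      chernForm L C = graphForm L ε a b c d := by
  obtain ⟨ε, hε, H⟩ := exists_chernForm_eq L
  refine ⟨ε, hε, ?_, fun C α a b c d hC h₁ h₂ => ?_⟩
  · refine H (ContinuousLinearMap.fst ℂ ℂ ℂ) _ (fun h => ?_) (fun v => ?_) (fun m => coord₁ L m.1)
      (fun m => coord₂ L m.1) fun m => coe_eq_coord m.1
    · simpa using DFunLike.congr_fun h ((1, 0) : ℂ × ℂ)
    · show proj L v.1 = proj L 0 ↔ _
      rw [proj_eq_iff]; simp
  · refine H (ContinuousLinearMap.snd ℂ ℂ ℂ - α • ContinuousLinearMap.fst ℂ ℂ ℂ) C (fun h => ?_)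
      (fun v => by simpa using hC v) _ _ fun m => ?_
    · simpa using DFunLike.congr_fun h ((0, 1) : ℂ × ℂ)
    · simp only [period, sub_apply, smul_apply,
        ContinuousLinearMap.coe_snd', ContinuousLinearMap.coe_fst', smul_eq_mul]
      rw [coe_eq_coord m.1, coe_eq_coord m.2]
      push_cast
      linear_combination (-(coord₁ L m.1 : ℂ)) * h₁ - (coord₂ L m.1 : ℂ) * h₂

lemma cupPairing_graphForm {ε : ℤ} (hε : ε * ε = 1) (a b c d a' b' c' d' : ℤ) :
    cupPairing L (graphForm L ε a b c d) (graphForm L ε a' b' c' d') =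
      (a - a') * (d - d') - (b - b') * (c - c') := by
  simp [cupPairing, graphForm, latticeBasis, coord₁, coord₂]
  linear_combination ((a - a') * (d - d') - (b - b') * (c - c')) * hε

lemma cupPairing_fibreForm_graphForm {ε : ℤ} (hε : ε * ε = 1) (a b c d : ℤ) :
    cupPairing L (fibreForm L ε) (graphForm L ε a b c d) = 1 := by
  simp [cupPairing, graphForm, fibreForm, latticeBasis, coord₁, coord₂, hε]

lemma cupPairing_graphForm_fibreForm {ε : ℤ} (hε : ε * ε = 1) (a b c d : ℤ) :
    cupPairing L (graphForm L ε a b c d) (fibreForm L ε) = 1 := by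
  simp [cupPairing, graphForm, fibreForm, latticeBasis, coord₁, coord₂, hε]

lemma cupPairing_fibreForm (ε : ℤ) : cupPairing L (fibreForm L ε) (fibreForm L ε) = 0 := by
  simp [cupPairing, fibreForm, latticeBasis, coord₁, coord₂]

end ChernForms

section Main

open Complex

/-- A complex number that is equal to `σ` or to its conjugate has the same norms as `σ`. -/
lemma norm_eq_of_mul_sub_conj_eq_zero {α σ : ℂ} (h : (α - σ) * (α - (starRingEnd ℂ) σ) = 0) :
    ‖α‖ = ‖σ‖ ∧ ‖1 - α‖ = ‖1 - σ‖ := by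
  rcases mul_eq_zero.1 h with h | h
  · rw [sub_eq_zero.1 h]; simp
  · rw [sub_eq_zero.1 h, norm_conj, ← norm_conj (1 - σ)]; simp

lemma exists_trace_norm {σ : ℂ} (hσ : (∃ e : ℕ, 0 < e ∧ σ = (Real.sqrt e : ℂ) * I) ∨
    (∃ e : ℕ, e % 4 = 3 ∧ σ = (1 + (Real.sqrt e : ℂ) * I) / 2)) :
    ∃ t n : ℤ, σ + (starRingEnd ℂ) σ = t ∧ σ * (starRingEnd ℂ) σ = n := by
  have hsq : ∀ e : ℕ, (Real.sqrt e : ℂ) * (Real.sqrt e : ℂ) = e := fun e => by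
    rw [← ofReal_mul, Real.mul_self_sqrt (Nat.cast_nonneg e)]; simp
  rcases hσ with ⟨e, -, rfl⟩ | ⟨e, he, rfl⟩
  · refine ⟨0, e, by simp, ?_⟩
    simp only [map_mul, conj_ofReal, conj_I]
    push_cast
    linear_combination hsq e - (Real.sqrt e : ℂ) * (Real.sqrt e : ℂ) * I_sq
  · obtain ⟨k, hk⟩ : ∃ k, e + 1 = 4 * k := ⟨(e + 1) / 4, by omega⟩
    have hk' : (e : ℂ) + 1 = 4 * k := by exact_mod_cast hk
    refine ⟨1, k, ?_, ?_⟩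
    · simp only [map_div₀, map_add, map_mul, map_one, conj_ofReal, conj_I, map_ofNat]
      push_cast; ring
    · simp only [map_div₀, map_add, map_mul, map_one, conj_ofReal, conj_I, map_ofNat]
      push_cast
      linear_combination hk' / 4 + hsq e / 4 - (Real.sqrt e : ℂ) * (Real.sqrt e : ℂ) * I_sq / 4

end Main

end EllipticSquare

end

theorem mainTheorem6 (L : PeriodPair) (σ : ℂ)
    (hσ : (∃ e : ℕ, 0 < e ∧ σ = (Real.sqrt e : ℂ) * Complex.I) ∨
      (∃ e : ℕ, e % 4 = 3 ∧ σ = (1 + (Real.sqrt e : ℂ) * Complex.I) / 2))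
    (ι : EllipticSquare.endRing L ≃+* Algebra.adjoin ℤ ({σ} : Set ℂ))
    (φ : EllipticSquare.endRing L) (hφ : (ι φ : ℂ) = σ) :
    (EllipticSquare.intersectionMatrix L
        ![EllipticSquare.fibre₁ L, EllipticSquare.fibre₂ L, EllipticSquare.diag L,
          EllipticSquare.graph L φ.1]).map (fun k : ℤ => (k : ℝ)) =
      !![0, 1, 1, 1;
         1, 0, 1, ‖σ‖ ^ 2;
         1, 1, 0, ‖1 - σ‖ ^ 2;
         1, ‖σ‖ ^ 2, ‖1 - σ‖ ^ 2, 0] := by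
  open EllipticSquare in
  obtain ⟨t, n, ht, hn⟩ := exists_trace_norm hσ
  obtain ⟨α, hα⟩ := exists_multiplier φ
  have hrel : φ * φ = t • φ - n • (1 : endRing L) := by
    apply ι.injective
    apply Subtype.ext
    rw [map_mul, map_sub, map_zsmul, map_zsmul, map_one]
    push_cast
    rw [hφ]
    simp only [zsmul_eq_mul, mul_one]
    rw [← ht, ← hn]; ring
  have hα2 := multiplier_sq hα hrel
  obtain ⟨hnorm, hnorm'⟩ := norm_eq_of_mul_sub_conj_eq_zero (α := α) (σ := σ) (by
    rw [← ht, ← hn] at hα2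
    linear_combination hα2)
  obtain ⟨a, b, h₁⟩ :=
    (mem_lattice_iff_int L _).1 (mul_mem_lattice_of_multiplier hα L.ω₁_mem_lattice)
  obtain ⟨c, d, h₂⟩ :=
    (mem_lattice_iff_int L _).1 (mul_mem_lattice_of_multiplier hα L.ω₂_mem_lattice)
  obtain ⟨ε, hε, hF₁, H⟩ := exists_chernForm_eq_graphForm L
  have hF₂ : chernForm L (fibre₂ L) = graphForm L ε 0 0 0 0 :=
    H _ 0 0 0 0 0 (fun v => by
      show proj L v.2 = proj L 0 ↔ _
      rw [proj_eq_iff]; simp) (by simp) (by simp)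
  have hΔ : chernForm L (diag L) = graphForm L ε 1 0 0 1 :=
    H _ 1 1 0 0 1 (fun v => by
      show proj L v.2 = proj L v.1 ↔ _
      rw [proj_eq_iff, one_mul]) (by simp) (by simp)
  have hΓ : chernForm L (graph L φ.1) = graphForm L ε a b c d :=
    H _ α a b c d (fun v => by
      show proj L v.2 = φ.1 (proj L v.1) ↔ _
      rw [hα, proj_eq_iff]) h₁ h₂
  have hdet := det_eq_norm_sq h₁ h₂
  have hdet' : (((1 - a) * (1 - d) - (-b) * (-c) : ℤ) : ℝ) = ‖1 - α‖ ^ 2 :=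
    det_eq_norm_sq (L := L) (by push_cast; linear_combination -h₁)
      (by push_cast; linear_combination -h₂)
  rw [hnorm] at hdet
  rw [hnorm'] at hdet'
  push_cast at hdet hdet'
  ext i j
  fin_cases i <;> fin_cases j <;>
    simp [intersectionMatrix, intersectionNumber, hF₁, hF₂, hΔ, hΓ, cupPairing_fibreForm,
      cupPairing_fibreForm_graphForm hε, cupPairing_graphForm_fibreForm hε,
      cupPairing_graphForm hε, ← hdet, ← hdet']
  ring
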